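/- Fix a response dimension $q \ge 1$ and $\tau \in (0,1)$. There is an integer $N$, depending only on $q$ and $\tau$, such that the following holds. Let $n, p \ge 0$ be integers, $X \in \mathbb{R}^{p\times n}$ a design matrix, $M_o \subseteq \{1,\dots,p\}$, $B^0 \in \mathbb{R}^{q\times |M_o|}$, and $V^0 \in \mathbb{R}^{q\times q}$ symmetric positive definite. For $M \subseteq \{1,\dots,p\}$ let $X_{M}$ be the submatrix of $X$ formed by the rows with index in $M$. Suppose that the random $q\times n$ matrix $Y$ satisfies $$Y \sim \text{Matrix-Normal}_{q,n}\big(B^0 X_{M_o},\, V^0,\, I_n\big),$$ i.e. $\operatorname{vec}(Y) \sim \mathrm{N}\big(\operatorname{vec}(B^0X_{M_o}),\, I_n\otimes V^0\big)$. For $M \subseteq \{1,\dots,p\}$ let $H_M$ be the orthogonal projection of $\mathbb{R}^n$ onto the row space of $X_M$ (so $H_M = X_M^\top (X_MX_M^\top)^{-1}X_M$ if $X_M$ has full row rank), and let $\widehat\Sigma_M := Y(I_n-H_M)Y^\top$. Then, for every $M$ with $n > |M|+2q$ and for $n$ sufficiently large, namely $n \ge |M| + N$, $$\mathbb{P}\Big(\lambda_{\min}(\widehat\Sigma_M)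 \ \ge\ \tau\,(n-|M|)\,\lambda_{\min}(V^0)\Big) \ >\ 1-\exp\Big(-\tfrac12(1-\sqrt\tau)^2(n-|M|)\Big).$$ -/

import Mathlib

open MeasureTheory ProbabilityTheory
open scoped Matrix Kronecker

noncomputable section

/-- The smallest eigenvalue `λ_min(A)` of a (symmetric) real matrix: the spectrum of a square
matrix is the finite set of its eigenvalues, which is non-empty for a symmetric matrix of
positive size. -/
def minEigenvalue {q : ℕ} (A : Matrix (Fin q) (Fin q) ℝ) : ℝ :=
  sInf (spectrum ℝ A)

/-- `Y ~ Matrix-Normal_{m,r}(C, U, V)`: the column-stacked vector `vec Y` is multivariate normal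
with mean `vec C` and covariance matrix `V ⊗ U`. -/
def HasMatrixNormalLaw {Ω : Type*} [MeasurableSpace Ω] {m r : ℕ}
    (Y : Ω → Matrix (Fin m) (Fin r) ℝ) (C : Matrix (Fin m) (Fin r) ℝ)
    (U : Matrix (Fin m) (Fin m) ℝ) (V : Matrix (Fin r) (Fin r) ℝ) (P : Measure Ω) : Prop :=
  HasLaw (fun ω => WithLp.toLp 2 (Y ω).vec)
    (multivariateGaussian (WithLp.toLp 2 C.vec) (V ⊗ₖ U)) P

/-- The submatrix `X_M` of the design matrix `X` formed by the rows with index in `M`. -/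
def rowSub {p n : ℕ} (X : Matrix (Fin p) (Fin n) ℝ) (M : Finset (Fin p)) : Matrix M (Fin n) ℝ :=
  X.submatrix (fun j : M => (j : Fin p)) id

/-- The row space of `X_M`, as a subspace of the Euclidean space `ℝⁿ`. -/
def rowSpace {p n : ℕ} (X : Matrix (Fin p) (Fin n) ℝ) (M : Finset (Fin p)) :
    Submodule ℝ (EuclideanSpace ℝ (Fin n)) :=
  Submodule.span ℝ (Set.range fun j : M => WithLp.toLp 2 (rowSub X M j))

/-- `H_M`, the matrix of the orthogonal projection of `ℝⁿ` onto the row space of `X_M`. It equals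
`X_Mᵀ (X_M X_Mᵀ)⁻¹ X_M` whenever `X_M` has full row rank (`hatMatrix_eq`). -/
def hatMatrix {p n : ℕ} (X : Matrix (Fin p) (Fin n) ℝ) (M : Finset (Fin p)) :
    Matrix (Fin n) (Fin n) ℝ :=
  (Matrix.toEuclideanCLM (n := Fin n) (𝕜 := ℝ)).symm (rowSpace X M).starProjection

/-- The residual sum of squares matrix `Σ̂_M = Y (I - H_M) Yᵀ`. -/
def rssMatrix {p n q : ℕ} (X : Matrix (Fin p) (Fin n) ℝ) (M : Finset (Fin p))
    (Y : Matrix (Fin q) (Fin n) ℝ) : Matrix (Fin q) (Fin q) ℝ :=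
  Y * (1 - hatMatrix X M) * Yᵀ

/-- The closed formula for the projection in the full row rank case. -/
theorem hatMatrix_eq {p n : ℕ} (X : Matrix (Fin p) (Fin n) ℝ) (M : Finset (Fin p))
    (h : IsUnit (rowSub X M * (rowSub X M)ᵀ).det) :
    hatMatrix X M = (rowSub X M)ᵀ * (rowSub X M * (rowSub X M)ᵀ)⁻¹ * rowSub X M := by
  set Z := rowSub X M with hZ
  rw [hatMatrix, StarAlgEquiv.symm_apply_eq]
  ext1 v
  symm
  have key : Matrix.toEuclideanCLM (n := Fin n) (𝕜 := ℝ)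
      (Zᵀ * (Z * Zᵀ)⁻¹ * Z) v = WithLp.toLp 2 (Zᵀ *ᵥ (((Z * Zᵀ)⁻¹ * Z) *ᵥ v.ofLp)) := by
    ext i
    simp [Matrix.mulVec_mulVec, Matrix.mul_assoc]
  rw [key]
  symm
  apply Submodule.eq_starProjection_of_mem_of_inner_eq_zero
  · have : WithLp.toLp 2 (Zᵀ *ᵥ (((Z * Zᵀ)⁻¹ * Z) *ᵥ v.ofLp)) =
        ∑ j : M, (((Z * Zᵀ)⁻¹ * Z) *ᵥ v.ofLp) j • WithLp.toLp 2 (rowSub X M j) := by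
      ext i
      simp [Matrix.mulVec, dotProduct, hZ, mul_comm]
    rw [this]
    exact Submodule.sum_mem _ fun j _ =>
      Submodule.smul_mem _ _ (Submodule.subset_span ⟨j, rfl⟩)
  · intro w hw
    have hker : Z *ᵥ (v.ofLp - Zᵀ *ᵥ (((Z * Zᵀ)⁻¹ * Z) *ᵥ v.ofLp)) = 0 := by
      rw [Matrix.mulVec_sub, Matrix.mulVec_mulVec, Matrix.mulVec_mulVec, ← Matrix.mul_assoc,
        Matrix.mul_nonsing_inv _ h, Matrix.one_mul, sub_self]
    induction hw using Submodule.span_induction with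
    | mem x hx =>
      obtain ⟨j, rfl⟩ := hx
      have := congrFun hker j
      simpa [PiLp.inner_apply, Matrix.mulVec, dotProduct, hZ] using this
    | zero => simp
    | add x y _ _ hx hy => rw [inner_add_right, hx, hy, add_zero]
    | smul a x _ hx => rw [inner_smul_right, hx, mul_zero]

end

/-! Put `d = n - |M|`. The mean `B₀ X_{M₀}` has row space of dimension at most `q`, so some `d - q`
orthonormal vectors `b j` are orthogonal both to it and to the row space of `X_M`. Testing `Y`
against them kills the mean whether or not `M` contains `M₀`, and by Bessel it only lowers the
quadratic form of the residual matrix. After whitening by `S = √V₀`, what remains is a `(d - q) × q`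
standard Gaussian matrix (`HasMatrixNormalLaw.hasLaw_stdGaussian`).

Its least singular value is at least `√τ √d` outside a small event
(`exists_lower_bound_gaussian_map`): chi-square Chernoff bounds on a finite net of the sphere, plus
a crude operator norm bound. The net and the `q` lost dimensions cost only a factor independent of
`d`. The Chernoff rate strictly exceeds the rate claimed, so this factor is absorbed for large `d`.
-/

/-! ### Chi-square tails. -/

theorem integral_exp_mul_sq_gaussianReal {t : ℝ} (ht : t < 1 / 2) :
    ∫ x, Real.exp (t * x ^ 2) ∂gaussianReal 0 1 = (√(1 - 2 * t))⁻¹ := by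
  rw [integral_gaussianReal_eq_integral_smul one_ne_zero]
  have h : ∀ x : ℝ, gaussianPDFReal 0 1 x • Real.exp (t * x ^ 2) =
      (√(2 * Real.pi))⁻¹ * Real.exp (-((1 - 2 * t) / 2) * x ^ 2) := by
    intro x
    rw [gaussianPDFReal, smul_eq_mul, mul_assoc, ← Real.exp_add]
    norm_num
    exact Or.inl (by ring)
  have h0 : 0 < 1 - 2 * t := by linarith
  simp_rw [h]
  rw [integral_const_mul, integral_gaussian, ← Real.sqrt_inv, ← Real.sqrt_inv,
    ← Real.sqrt_mul (by positivity)]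
  congr 1
  field_simp

theorem mgf_norm_sq_stdGaussian {ι : Type*} [Fintype ι] {t : ℝ} (ht : t < 1 / 2) :
    mgf (fun x => ‖x‖ ^ 2) (stdGaussian (EuclideanSpace ℝ ι)) t =
      (√(1 - 2 * t))⁻¹ ^ Fintype.card ι := by
  rw [mgf, ← map_pi_eq_stdGaussian, integral_map (by fun_prop)
    (Measurable.aestronglyMeasurable (by fun_prop))]
  simp_rw [EuclideanSpace.real_norm_sq_eq, Finset.mul_sum, Real.exp_sum]
  rw [integral_fintype_prod_eq_prod (f := fun _ x => Real.exp (t * x ^ 2))]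
  simp [integral_exp_mul_sq_gaussianReal ht]

/-- A non-integrable function has Bochner integral `0`, whereas the value computed above is
positive. -/
theorem integrable_exp_mul_norm_sq_stdGaussian {ι : Type*} [Fintype ι] {t : ℝ} (ht : t < 1 / 2) :
    Integrable (fun x => Real.exp (t * ‖x‖ ^ 2)) (stdGaussian (EuclideanSpace ℝ ι)) := by
  by_contra h
  have h1 := mgf_norm_sq_stdGaussian (ι := ι) ht
  rw [mgf, integral_undef h] at h1
  have h0 : 0 < 1 - 2 * t := by linarith
  have : 0 < (√(1 - 2 * t))⁻¹ ^ Fintype.card ι := by positivity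
  exact this.ne h1

theorem stdGaussian_norm_sq_le_le {ι : Type*} [Fintype ι] {s : ℝ} (hs0 : 0 < s) (hs1 : s < 1)
    (ε : ℝ) :
    (stdGaussian (EuclideanSpace ℝ ι)).real {x | ‖x‖ ^ 2 ≤ ε} ≤
      Real.exp (((s ^ 2)⁻¹ - 1) / 2 * ε) * s ^ Fintype.card ι := by
  have h1 : 1 ≤ (s ^ 2)⁻¹ := (one_le_inv₀ (by positivity)).2 (pow_le_one₀ hs0.le hs1.le)
  have ht : -(((s ^ 2)⁻¹ - 1) / 2) < 1 / 2 := by linarith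
  -- This exponent makes `1 - 2t = s⁻²`, so the moment generating function is a power of `s`.
  have h := measure_le_le_exp_mul_mgf (μ := stdGaussian (EuclideanSpace ℝ ι))
    (X := fun x => ‖x‖ ^ 2) ε (t := -(((s ^ 2)⁻¹ - 1) / 2)) (by linarith)
    (integrable_exp_mul_norm_sq_stdGaussian ht)
  rw [mgf_norm_sq_stdGaussian ht] at h
  have e : 1 - 2 * -(((s ^ 2)⁻¹ - 1) / 2) = (s⁻¹) ^ 2 := by rw [inv_pow]; ring
  rwa [e, Real.sqrt_sq (by positivity), inv_inv, neg_neg] at h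

theorem stdGaussian_le_norm_sq_le {ι : Type*} [Fintype ι] (ε : ℝ) :
    (stdGaussian (EuclideanSpace ℝ ι)).real {x | ε ≤ ‖x‖ ^ 2} ≤
      Real.exp (-ε / 4) * √2 ^ Fintype.card ι := by
  have ht : (1 / 4 : ℝ) < 1 / 2 := by norm_num
  have h := measure_ge_le_exp_mul_mgf (μ := stdGaussian (EuclideanSpace ℝ ι))
    (X := fun x => ‖x‖ ^ 2) ε (t := 1 / 4) (by norm_num)
    (integrable_exp_mul_norm_sq_stdGaussian ht)
  rw [mgf_norm_sq_stdGaussian ht, ← Real.sqrt_inv] at h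
  convert! h using 3
  · ring
  · norm_num

/-- Strictness at `s` itself is `log s < s - 1`; continuity then leaves room for `s' > s`, which
pays for the net. -/
theorem exists_sq_lt_rate {s : ℝ} (hs0 : 0 < s) (hs1 : s < 1) :
    ∃ s', s < s' ∧ s' < 1 ∧ (1 - s) ^ 2 < s' ^ 2 - 1 - 2 * Real.log s' := by
  have hc : ContinuousAt (fun x : ℝ => x ^ 2 - 1 - 2 * Real.log x) s := by
    have := Real.continuousAt_log hs0.ne'
    fun_prop
  have h0 : (1 - s) ^ 2 < s ^ 2 - 1 - 2 * Real.log s := by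
    have := Real.log_lt_sub_one_of_pos hs0 hs1.ne
    nlinarith
  have h1 := (hc.eventually (lt_mem_nhds h0)).filter_mono (nhdsWithin_le_nhds (s := Set.Ioi s))
  obtain ⟨x, hx, hx1⟩ := (h1.and (Ioo_mem_nhdsGT hs1)).exists
  exact ⟨x, hx1.1, hx1.2, hx⟩

/-! ### Nets and the least singular value of a Gaussian matrix. -/

theorem exists_finite_net_sphere {E : Type*} [NormedAddCommGroup E] [NormedSpace ℝ E]
    [FiniteDimensional ℝ E] {ε : ℝ} (hε : 0 < ε) :
    ∃ t : Finset E, (∀ v ∈ t, ‖v‖ = 1) ∧ ∀ w : E, ‖w‖ = 1 → ∃ v ∈ t, ‖w - v‖ ≤ ε := by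
  obtain ⟨t, ht, hf, hc⟩ := (isCompact_sphere (0 : E) 1).finite_cover_balls hε
  refine ⟨hf.toFinset, fun v hv => by simpa using ht (hf.mem_toFinset.1 hv), fun w hw => ?_⟩
  have hw' : w ∈ Metric.sphere (0 : E) 1 := by simpa using hw
  obtain ⟨v, hv, hd⟩ := Set.mem_iUnion₂.1 (hc hw')
  exact ⟨v, hf.mem_toFinset.2 hv, by simpa [dist_eq_norm] using (Metric.mem_ball.1 hd).le⟩

theorem norm_map_le_of_basis {q : ℕ} {F : Type*} [NormedAddCommGroup F] [NormedSpace ℝ F]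
    (z : EuclideanSpace ℝ (Fin q) →ₗ[ℝ] F) {K : ℝ}
    (h : ∀ i, ‖z (EuclideanSpace.single i 1)‖ ≤ K) (x : EuclideanSpace ℝ (Fin q)) :
    ‖z x‖ ≤ q * K * ‖x‖ := by
  have hx : x = ∑ i, x i • EuclideanSpace.single i (1 : ℝ) := by
    simpa using ((EuclideanSpace.basisFun (Fin q) ℝ).sum_repr x).symm
  calc ‖z x‖ = ‖∑ i, x i • z (EuclideanSpace.single i (1 : ℝ))‖ := by
        conv_lhs => rw [hx]
        simp
    _ ≤ ∑ i, ‖x i • z (EuclideanSpace.single i (1 : ℝ))‖ := norm_sum_le _ _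
    _ ≤ ∑ _i : Fin q, ‖x‖ * K := by
        refine Finset.sum_le_sum fun i _ => ?_
        rw [norm_smul]
        exact mul_le_mul (PiLp.norm_apply_le x i) (h i) (norm_nonneg _) (norm_nonneg _)
    _ = q * K * ‖x‖ := by simp; ring

theorem le_norm_map_of_net {q : ℕ} {F : Type*} [NormedAddCommGroup F] [NormedSpace ℝ F]
    (z : EuclideanSpace ℝ (Fin q) →ₗ[ℝ] F) {K ε c : ℝ} (hK : 0 ≤ K)
    (h : ∀ i, ‖z (EuclideanSpace.single i 1)‖ ≤ K) {v w : EuclideanSpace ℝ (Fin q)}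
    (hv : c + q * K * ε ≤ ‖z v‖) (hvw : ‖w - v‖ ≤ ε) : c ≤ ‖z w‖ := by
  have h1 := norm_map_le_of_basis z h (w - v)
  have h2 : ‖z v‖ ≤ ‖z w‖ + ‖z (w - v)‖ := by
    rw [map_sub, norm_sub_rev]
    exact (norm_le_norm_add_norm_sub' _ _)
  have h3 : q * K * ‖w - v‖ ≤ q * K * ε := by gcongr
  linarith

theorem exists_nat_const_mul_exp_lt (C : ℝ) {a b : ℝ} (hab : b < a) :
    ∃ N : ℕ, ∀ d : ℕ, N ≤ d → C * Real.exp (-a * d) < Real.exp (-b * d) := by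
  obtain ⟨N, hN⟩ := exists_nat_gt (C / (a - b))
  refine ⟨N, fun d hd => ?_⟩
  have h1 : C < (a - b) * d := by
    rw [div_lt_iff₀' (by linarith)] at hN
    refine hN.trans_le ?_
    have : (N : ℝ) ≤ d := by exact_mod_cast hd
    exact mul_le_mul_of_nonneg_left this (by linarith)
  have h2 : C < Real.exp ((a - b) * d) := by
    have := Real.add_one_le_exp ((a - b) * d)
    linarith
  calc C * Real.exp (-a * d) < Real.exp ((a - b) * d) * Real.exp (-a * d) := by gcongr
    _ = _ := by rw [← Real.exp_add]; ring_nf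

theorem exists_lower_bound_gaussian_map (q : ℕ) (hq : 0 < q) {s : ℝ} (hs0 : 0 < s) (hs1 : s < 1) :
    ∃ N : ℕ, ∀ d : ℕ, N ≤ d → q ≤ d → ∀ {Ω : Type*} [MeasurableSpace Ω] (P : Measure Ω)
      [IsProbabilityMeasure P]
      (Z : Ω → EuclideanSpace ℝ (Fin q) →ₗ[ℝ] EuclideanSpace ℝ (Fin (d - q))),
      (∀ v, ‖v‖ = 1 → HasLaw (fun ω => Z ω v) (stdGaussian _) P) →
      1 - Real.exp (-((1 - s) ^ 2 * d / 2)) <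
        P.real {ω | ∀ v, ‖v‖ = 1 → s * √d ≤ ‖Z ω v‖} := by
  obtain ⟨s', hss, hs1', hrate⟩ := exists_sq_lt_rate hs0 hs1
  have hs0' : 0 < s' := hs0.trans hss
  set f : ℝ := (s' ^ 2 - 1 - 2 * Real.log s') / 2 with hf
  have hf0 : 0 < f := by nlinarith [sq_nonneg (1 - s)]
  -- Chosen so that `exp (-K² d / 4) * exp (d / 2) = exp (-f d)` in `hup`.
  set K : ℝ := √(4 * f + 2) with hKdef
  have hK : 0 < K := by positivity
  have hK2 : K ^ 2 = 4 * f + 2 := Real.sq_sqrt (by positivity)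
  have hqr : (0 : ℝ) < q := by exact_mod_cast hq
  -- With columns bounded by `K √d`, moving by this radius changes `‖Z ω v‖` by at most `(s' - s)
  -- √d`.
  obtain ⟨t, ht1, ht⟩ := exists_finite_net_sphere (E := EuclideanSpace ℝ (Fin q))
    (ε := (s' - s) / (q * K)) (div_pos (by linarith) (by positivity))
  obtain ⟨N, hN⟩ := exists_nat_const_mul_exp_lt (t.card * (s' ^ q)⁻¹ + q) (a := f)
    (b := (1 - s) ^ 2 / 2) (by rw [hf]; linarith)
  refine ⟨N, fun d hd hqd Ω _ P _ Z hZ => ?_⟩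
  have hlow : ∀ v ∈ t, P.real {ω | ‖Z ω v‖ ^ 2 ≤ s' ^ 2 * d} ≤ (s' ^ q)⁻¹ * Real.exp (-f * d) := by
    intro v hv
    rw [(hZ v (ht1 v hv)).measureReal_eq (p := fun x => ‖x‖ ^ 2 ≤ s' ^ 2 * d)
      (measurableSet_le (by fun_prop) (by fun_prop))]
    refine (stdGaussian_norm_sq_le_le hs0' hs1' _).trans_eq ?_
    have hsd : s' ^ d = Real.exp (d * Real.log s') := by
      rw [Real.exp_nat_mul, Real.exp_log hs0']
    rw [Fintype.card_fin, pow_sub₀ _ hs0'.ne' hqd, hsd, mul_comm (Real.exp (d * _)),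
      mul_left_comm, ← Real.exp_add]
    congr 2
    rw [hf]
    field_simp
    ring
  have hup : ∀ i : Fin q, P.real {ω | K ^ 2 * d ≤ ‖Z ω (EuclideanSpace.single i 1)‖ ^ 2} ≤
      Real.exp (-f * d) := by
    intro i
    rw [(hZ (EuclideanSpace.single i 1) (by simp)).measureReal_eq
      (p := fun x => K ^ 2 * d ≤ ‖x‖ ^ 2) (measurableSet_le (by fun_prop) (by fun_prop))]
    refine (stdGaussian_le_norm_sq_le _).trans ?_
    have h2 : √2 ≤ Real.exp (1 / 2) := by
      rw [Real.sqrt_le_left (by positivity), ← Real.exp_nat_mul]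
      have := Real.add_one_le_exp (1 : ℝ)
      norm_num at this ⊢
      exact this
    calc Real.exp (-(K ^ 2 * d) / 4) * √2 ^ Fintype.card (Fin (d - q))
        ≤ Real.exp (-(K ^ 2 * d) / 4) * √2 ^ d := by
          gcongr
          · exact Real.one_le_sqrt.2 one_le_two
          · simp
      _ ≤ Real.exp (-(K ^ 2 * d) / 4) * Real.exp (1 / 2) ^ d := by gcongr
      _ = Real.exp (-f * d) := by
          rw [← Real.exp_nat_mul, ← Real.exp_add, hK2]
          ring_nf
  set A := {ω | ∀ v, ‖v‖ = 1 → s * √d ≤ ‖Z ω v‖} with hA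
  set L := ⋃ v ∈ t, {ω | ‖Z ω v‖ ^ 2 ≤ s' ^ 2 * d} with hL
  set U := ⋃ i ∈ (Finset.univ : Finset (Fin q)),
    {ω | K ^ 2 * d ≤ ‖Z ω (EuclideanSpace.single i 1)‖ ^ 2} with hU
  -- Covering the whole space and using subadditivity avoids proving `A` measurable.
  have hcover : Set.univ ⊆ A ∪ (L ∪ U) := by
    intro ω _
    by_contra hω
    simp only [Set.mem_union, not_or, hL, hU, Set.mem_iUnion, Set.mem_ofPred_eq, not_exists,
      not_le] at hω
    obtain ⟨h1, h2, h3⟩ := hω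
    refine h1 fun w hw => ?_
    obtain ⟨v, hv, hvw⟩ := ht w hw
    refine le_norm_map_of_net (Z ω) (K := K * √d) (by positivity) (fun i => ?_) ?_ hvw
    · refine (abs_le_of_sq_le_sq' ?_ (by positivity)).2
      rw [mul_pow, Real.sq_sqrt (Nat.cast_nonneg d)]
      exact (h3 i (Finset.mem_univ i)).le
    · have e : s * √d + q * (K * √d) * ((s' - s) / (q * K)) = s' * √d := by
        field_simp
        ring
      rw [e]
      refine (abs_le_of_sq_le_sq' ?_ (by positivity)).2
      rw [mul_pow, Real.sq_sqrt (Nat.cast_nonneg d)]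
      exact (h2 v hv).le
  have hLb : P.real L ≤ t.card * ((s' ^ q)⁻¹ * Real.exp (-f * d)) :=
    (measureReal_biUnion_finset_le _ _).trans
      ((Finset.sum_le_sum hlow).trans_eq (by simp))
  have hUb : P.real U ≤ q * Real.exp (-f * d) :=
    (measureReal_biUnion_finset_le _ _).trans
      ((Finset.sum_le_sum fun i _ => hup i).trans_eq (by simp))
  have h1 : 1 ≤ P.real A + (P.real L + P.real U) := by
    calc (1 : ℝ) = P.real Set.univ := by simp
      _ ≤ P.real (A ∪ (L ∪ U)) := measureReal_mono hcover
      _ ≤ P.real A + P.real (L ∪ U) := measureReal_union_le _ _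
      _ ≤ _ := by gcongr; exact measureReal_union_le _ _
  have h2 := hN d hd
  have e : -((1 - s) ^ 2 / 2) * d = -((1 - s) ^ 2 * d / 2) := by ring
  rw [e] at h2
  linarith

open scoped RealInnerProductSpace

/-! ### Eigenvalues, projections and the residual quadratic form. -/

theorem le_minEigenvalue {q : ℕ} (hq : 0 < q) {A : Matrix (Fin q) (Fin q) ℝ} (hA : A.IsHermitian)
    {c : ℝ} (h : ∀ u : EuclideanSpace ℝ (Fin q), ‖u‖ = 1 → c ≤ u.ofLp ⬝ᵥ A *ᵥ u.ofLp) :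
    c ≤ minEigenvalue A := by
  rw [minEigenvalue, hA.spectrum_real_eq_range_eigenvalues]
  have : Nonempty (Fin q) := ⟨⟨0, hq⟩⟩
  refine le_csInf (Set.range_nonempty _) ?_
  rintro _ ⟨i, rfl⟩
  rw [hA.eigenvalues_eq i]
  simpa using h (hA.eigenvectorBasis i) (hA.eigenvectorBasis.orthonormal.1 i)

open scoped MatrixOrder in
theorem minEigenvalue_mul_le {q : ℕ} {A : Matrix (Fin q) (Fin q) ℝ} (hA : A.IsHermitian)
    (u : Fin q → ℝ) : minEigenvalue A * (u ⬝ᵥ u) ≤ u ⬝ᵥ A *ᵥ u := by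
  have h : algebraMap ℝ (Matrix (Fin q) (Fin q) ℝ) (minEigenvalue A) ≤ A :=
    (algebraMap_le_iff_le_spectrum (show IsSelfAdjoint A from hA)).2 fun x hx =>
      csInf_le Matrix.finite_real_spectrum.bddBelow hx
  have := (Matrix.le_iff.1 h).dotProduct_mulVec_nonneg u
  rw [Matrix.sub_mulVec, dotProduct_sub, Algebra.algebraMap_eq_smul_one, Matrix.smul_mulVec,
    Matrix.one_mulVec, dotProduct_smul, smul_eq_mul] at this
  simpa using this

open scoped MatrixOrder in
theorem Matrix.PosDef.exists_symm_sqrt {q : ℕ} {V : Matrix (Fin q) (Fin q) ℝ} (hV : V.PosDef) :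
    ∃ S : Matrix (Fin q) (Fin q) ℝ, Sᵀ = S ∧ S * S = V ∧ IsUnit S.det := by
  have h : CFC.sqrt V * CFC.sqrt V = V := CFC.sqrt_mul_sqrt_self _ hV.posSemidef.nonneg
  refine ⟨CFC.sqrt V, ?_, h, ?_⟩
  · have hs : IsSelfAdjoint (CFC.sqrt V) := (CFC.sqrt_nonneg V).isSelfAdjoint
    rw [← Matrix.conjTranspose_eq_transpose_of_trivial]
    exact hs
  · have := hV.isUnit
    rw [Matrix.isUnit_iff_isUnit_det, ← h, Matrix.det_mul] at this
    exact isUnit_of_mul_isUnit_left this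

theorem exists_orthonormal_orthogonal {n k : ℕ} (K : Submodule ℝ (EuclideanSpace ℝ (Fin n)))
    (hk : k + Module.finrank ℝ K ≤ n) :
    ∃ b : Fin k → EuclideanSpace ℝ (Fin n), Orthonormal ℝ b ∧ ∀ j, b j ∈ Kᗮ := by
  have h := K.finrank_add_finrank_orthogonal
  rw [finrank_euclideanSpace_fin] at h
  have hk' : k ≤ Module.finrank ℝ Kᗮ := by omega
  refine ⟨fun j => (stdOrthonormalBasis ℝ Kᗮ (Fin.castLE hk' j) : Kᗮ), ?_, fun j => SetLike.coe_mem _⟩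
  exact ((stdOrthonormalBasis ℝ Kᗮ).orthonormal.comp_linearIsometry Kᗮ.subtypeₗᵢ).comp _
    (Fin.castLE_injective hk')

theorem sum_inner_sq_le_inner_sub_starProjection {E ι : Type*} [NormedAddCommGroup E]
    [InnerProductSpace ℝ E] [Fintype ι] (K : Submodule ℝ E) [K.HasOrthogonalProjection]
    {b : ι → E} (hb : Orthonormal ℝ b) (hbK : ∀ j, b j ∈ Kᗮ) (y : E) :
    ∑ j, ⟪b j, y⟫ ^ 2 ≤ ⟪y, y - K.starProjection y⟫ := by
  have h1 : ⟪y, y - K.starProjection y⟫ = ‖y - K.starProjection y‖ ^ 2 := by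
    rw [← real_inner_self_eq_norm_sq, inner_sub_left (y) _ (y - _)]
    rw [Submodule.inner_right_of_mem_orthogonal (K.starProjection_apply_mem y)
      (K.sub_starProjection_mem_orthogonal y), sub_zero]
  have h2 : ∀ j, ⟪b j, y⟫ = ⟪b j, y - K.starProjection y⟫ := fun j => by
    rw [inner_sub_right, Submodule.inner_left_of_mem_orthogonal (K.starProjection_apply_mem y)
      (hbK j), sub_zero]
  rw [h1]
  simp_rw [h2]
  simpa using hb.sum_inner_products_le (y - K.starProjection y) (s := Finset.univ)

theorem hatMatrix_transpose {p n : ℕ} (X : Matrix (Fin p) (Fin n) ℝ) (M : Finset (Fin p)) :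
    (hatMatrix X M)ᵀ = hatMatrix X M := by
  have h : star (hatMatrix X M) = hatMatrix X M := by
    have hP : star (rowSpace X M).starProjection = (rowSpace X M).starProjection :=
      isSelfAdjoint_starProjection _
    apply EquivLike.injective (Matrix.toEuclideanCLM (n := Fin n) (𝕜 := ℝ))
    rw [map_star, hatMatrix, StarAlgEquiv.apply_symm_apply, hP]
  simpa [Matrix.star_eq_conjTranspose] using h

theorem rssMatrix_isHermitian {p n q : ℕ} (X : Matrix (Fin p) (Fin n) ℝ) (M : Finset (Fin p))
    (Y : Matrix (Fin q) (Fin n) ℝ) : (rssMatrix X M Y).IsHermitian := by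
  rw [Matrix.IsHermitian, Matrix.conjTranspose_eq_transpose_of_trivial, rssMatrix]
  simp [Matrix.transpose_mul, hatMatrix_transpose, Matrix.mul_assoc]

theorem sum_sq_le_dotProduct_rssMatrix {p n q : ℕ} {ι : Type*} [Fintype ι]
    (X : Matrix (Fin p) (Fin n) ℝ) (M : Finset (Fin p)) (Y : Matrix (Fin q) (Fin n) ℝ)
    {b : ι → EuclideanSpace ℝ (Fin n)} (hb : Orthonormal ℝ b)
    (hbK : ∀ j, b j ∈ (rowSpace X M)ᗮ) (u : Fin q → ℝ) :
    ∑ j, ((b j).ofLp ⬝ᵥ Yᵀ *ᵥ u) ^ 2 ≤ u ⬝ᵥ rssMatrix X M Y *ᵥ u := by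
  have h := sum_inner_sq_le_inner_sub_starProjection (rowSpace X M) hb hbK
    (WithLp.toLp 2 (Yᵀ *ᵥ u))
  have h1 : u ⬝ᵥ rssMatrix X M Y *ᵥ u = (Yᵀ *ᵥ u) ⬝ᵥ (1 - hatMatrix X M) *ᵥ (Yᵀ *ᵥ u) := by
    rw [rssMatrix, ← Matrix.mulVec_mulVec, ← Matrix.mulVec_mulVec, Matrix.dotProduct_mulVec,
      Matrix.mulVec_transpose]
  have h2 : Matrix.toEuclideanCLM (n := Fin n) (𝕜 := ℝ) (1 - hatMatrix X M) =
      1 - (rowSpace X M).starProjection := by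
    rw [map_sub, map_one, hatMatrix, StarAlgEquiv.apply_symm_apply]
  have h3 := Matrix.inner_toEuclideanCLM (1 - hatMatrix X M) (WithLp.toLp 2 (Yᵀ *ᵥ u))
    (WithLp.toLp 2 (Yᵀ *ᵥ u))
  rw [h2] at h3
  rw [h1]
  refine le_of_eq_of_le ?_ (h.trans_eq (h3.trans ?_))
  · simp [PiLp.inner_apply, dotProduct, mul_comm]
  · simp

/-! ### Gaussian law of the projected data, and conclusion. -/

theorem inner_vec_eq_dotProduct {n q : ℕ} (c : Fin n → ℝ) (w : Fin q → ℝ)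
    (A : Matrix (Fin q) (Fin n) ℝ) :
    ⟪(WithLp.toLp 2 fun x : Fin n × Fin q => c x.1 * w x.2), WithLp.toLp 2 A.vec⟫ =
      c ⬝ᵥ Aᵀ *ᵥ w := by
  simp only [PiLp.inner_apply, Fintype.sum_prod_type, dotProduct, Matrix.mulVec, Finset.mul_sum,
    Matrix.vec, Matrix.transpose_apply]
  refine Finset.sum_congr rfl fun i _ => Finset.sum_congr rfl fun a _ => ?_
  simp
  ring

theorem dotProduct_one_kronecker_mulVec {n q : ℕ} (c : Fin n → ℝ) (w : Fin q → ℝ)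
    (V : Matrix (Fin q) (Fin q) ℝ) :
    (fun x : Fin n × Fin q => c x.1 * w x.2) ⬝ᵥ
      ((1 : Matrix (Fin n) (Fin n) ℝ) ⊗ₖ V) *ᵥ (fun x => c x.1 * w x.2) =
      (c ⬝ᵥ c) * (w ⬝ᵥ V *ᵥ w) := by
  simp only [dotProduct, Matrix.mulVec, Fintype.sum_prod_type, Matrix.kroneckerMap_apply,
    Matrix.one_apply, ite_mul, one_mul, zero_mul, Finset.sum_mul_sum]
  refine Finset.sum_congr rfl fun i _ => ?_
  refine Finset.sum_congr rfl fun a _ => ?_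
  have h : ∀ x, (∑ y, if i = x then V a y * (c x * w y) else 0) =
      if i = x then ∑ y, V a y * (c x * w y) else 0 := fun x => by split_ifs <;> simp
  simp only [h, Finset.sum_ite_eq, Finset.mem_univ, if_true, Finset.mul_sum]
  exact Finset.sum_congr rfl fun y _ => by ring

theorem HasMatrixNormalLaw.hasLaw_stdGaussian {Ω : Type*} [MeasurableSpace Ω] {P : Measure Ω}
    {n q k : ℕ} {Y : Ω → Matrix (Fin q) (Fin n) ℝ} {C : Matrix (Fin q) (Fin n) ℝ}
    {V : Matrix (Fin q) (Fin q) ℝ} (hV : V.PosSemidef) (hY : HasMatrixNormalLaw Y C V 1 P)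
    {b : Fin k → EuclideanSpace ℝ (Fin n)} (hb : Orthonormal ℝ b) {w : Fin q → ℝ}
    (hw : w ⬝ᵥ V *ᵥ w = 1) (hC : ∀ j, (b j).ofLp ⬝ᵥ Cᵀ *ᵥ w = 0) :
    HasLaw (fun ω => WithLp.toLp 2 fun j => (b j).ofLp ⬝ᵥ (Y ω)ᵀ *ᵥ w)
      (stdGaussian (EuclideanSpace ℝ (Fin k))) P := by
  let g : Fin k → EuclideanSpace ℝ (Fin n × Fin q) := fun j =>
    WithLp.toLp 2 fun x => (b j) x.1 * w x.2
  let T : EuclideanSpace ℝ (Fin n × Fin q) → EuclideanSpace ℝ (Fin k) := fun x =>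
    WithLp.toLp 2 fun j => ⟪g j, x⟫
  have hTm : Measurable T := by fun_prop
  have hT : HasLaw T (stdGaussian (EuclideanSpace ℝ (Fin k)))
      (multivariateGaussian (WithLp.toLp 2 C.vec) ((1 : Matrix (Fin n) (Fin n) ℝ) ⊗ₖ V)) := by
    refine ⟨hTm.aemeasurable, ?_⟩
    have : IsProbabilityMeasure ((multivariateGaussian (WithLp.toLp 2 C.vec)
      ((1 : Matrix (Fin n) (Fin n) ℝ) ⊗ₖ V)).map T) :=
      Measure.isProbabilityMeasure_map hTm.aemeasurable
    apply Measure.ext_of_charFun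
    ext t
    -- The characteristic function of the image at `t` is that of `vec Y` at `∑ t j • g j`, a
    -- rank-one tensor; its variance factors as `‖t‖² * 1`.
    have hin : ∀ x, ⟪T x, t⟫ = ⟪x, ∑ j, t j • g j⟫ := fun x => by
      rw [inner_sum, PiLp.inner_apply]
      refine Finset.sum_congr rfl fun j _ => ?_
      rw [inner_smul_right, real_inner_comm]
      simp [T, real_inner_comm, mul_comm]
    rw [charFun_apply, integral_map hTm.aemeasurable
      (Measurable.aestronglyMeasurable (by fun_prop))]
    simp_rw [hin]
    rw [← charFun_apply, charFun_multivariateGaussian (Matrix.PosSemidef.one.kronecker hV),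
      charFun_stdGaussian]
    have h0 : ⟪∑ j, t j • g j, WithLp.toLp 2 C.vec⟫ = 0 := by
      rw [sum_inner]
      refine Finset.sum_eq_zero fun j _ => ?_
      rw [inner_smul_left, inner_vec_eq_dotProduct, hC, mul_zero]
    have hG : (∑ j, t j • g j).ofLp =
        fun x : Fin n × Fin q => (∑ j, t j • b j).ofLp x.1 * w x.2 := by
      ext x
      simp [g, Finset.sum_mul, mul_assoc]
    have hn : (∑ j, t j • b j).ofLp ⬝ᵥ (∑ j, t j • b j).ofLp = ‖t‖ ^ 2 := by
      have h1 := hb.inner_sum t.ofLp t.ofLp Finset.univ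
      rw [EuclideanSpace.real_norm_sq_eq]
      simp only [PiLp.inner_apply] at h1
      simpa [dotProduct, sq] using h1
    rw [h0, hG, dotProduct_one_kronecker_mulVec, hw, hn]
    simp [neg_div]
  have := hT.comp hY
  refine this.congr (Filter.Eventually.of_forall fun ω => ?_)
  ext j
  simp only [T, g, Function.comp]
  rw [inner_vec_eq_dotProduct]

theorem lemma1 (q : ℕ) (hq : 0 < q) (τ : ℝ) (hτ₀ : 0 < τ) (hτ₁ : τ < 1) :
    ∃ N : ℕ, ∀ (n p : ℕ) (X : Matrix (Fin p) (Fin n) ℝ) (M₀ : Finset (Fin p))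
      (B₀ : Matrix (Fin q) M₀ ℝ) (V₀ : Matrix (Fin q) (Fin q) ℝ), V₀.PosDef →
      ∀ {Ω : Type*} [MeasurableSpace Ω] (P : Measure Ω) [IsProbabilityMeasure P]
        (Y : Ω → Matrix (Fin q) (Fin n) ℝ),
        HasMatrixNormalLaw Y (B₀ * rowSub X M₀) V₀ 1 P →
        ∀ M : Finset (Fin p), M.card + 2 * q < n → M.card + N ≤ n →
          1 - Real.exp (-((1 - √τ) ^ 2 * ((n : ℝ) - M.card) / 2)) <
            P.real {ω | τ * ((n : ℝ) - M.card) * minEigenvalue V₀ ≤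
              minEigenvalue (rssMatrix X M (Y ω))} := by
  have hs0 : 0 < √τ := Real.sqrt_pos.2 hτ₀
  have hs1 : √τ < 1 := by rw [Real.sqrt_lt' one_pos]; simpa using hτ₁
  obtain ⟨N, hN⟩ := exists_lower_bound_gaussian_map q hq hs0 hs1
  refine ⟨N, fun n p X M₀ B₀ V₀ hV Ω _ P _ Y hY M hMq hMN => ?_⟩
  obtain ⟨S, hSt, hSS, hSu⟩ := hV.exists_symm_sqrt
  set C := B₀ * rowSub X M₀ with hCdef
  set d := n - M.card with hd
  have hdr : ((n : ℝ) - M.card) = d := by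
    rw [hd, Nat.cast_sub (by omega)]
  let R : Submodule ℝ (EuclideanSpace ℝ (Fin n)) :=
    Submodule.span ℝ (Set.range fun a : Fin q => WithLp.toLp 2 (C a))
  have hR : Module.finrank ℝ R ≤ q := by
    simpa [R, Set.finrank] using
      finrank_range_le_card (R := ℝ) (fun a : Fin q => WithLp.toLp 2 (C a))
  have hrow : Module.finrank ℝ (rowSpace X M) ≤ M.card := by
    have h := finrank_range_le_card (R := ℝ) (M := EuclideanSpace ℝ (Fin n))
      (fun j : M => WithLp.toLp 2 (rowSub X M j))
    rwa [Fintype.card_coe] at h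
  -- Dimension count: `(d - q) + |M| + q = n`.
  obtain ⟨b, hb, hbK⟩ := exists_orthonormal_orthogonal (k := d - q) (rowSpace X M ⊔ R) (by
    have := Submodule.finrank_add_le_finrank_add_finrank (rowSpace X M) R
    omega)
  have hbC : ∀ j, ∀ w : Fin q → ℝ, (b j).ofLp ⬝ᵥ Cᵀ *ᵥ w = 0 := fun j w => by
    have h : Cᵀᵀ *ᵥ (b j).ofLp = 0 := by
      ext a
      have := Submodule.inner_right_of_mem_orthogonal
        (Submodule.mem_sup_right (S := rowSpace X M) (Submodule.subset_span ⟨a, rfl⟩ :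
          WithLp.toLp 2 (C a) ∈ R)) (hbK j)
      simpa [PiLp.inner_apply, Matrix.mulVec, dotProduct, mul_comm] using this
    rw [Matrix.dotProduct_mulVec, ← Matrix.mulVec_transpose, h, zero_dotProduct]
  let Bm : Matrix (Fin (d - q)) (Fin n) ℝ := Matrix.of fun j => (b j).ofLp
  let Z : Ω → EuclideanSpace ℝ (Fin q) →ₗ[ℝ] EuclideanSpace ℝ (Fin (d - q)) := fun ω =>
    Matrix.toEuclideanLin (Bm * (Y ω)ᵀ * S⁻¹)
  have hZ : ∀ ω v, Z ω v = WithLp.toLp 2 fun j => (b j).ofLp ⬝ᵥ (Y ω)ᵀ *ᵥ (S⁻¹ *ᵥ v.ofLp) := by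
    intro ω v
    ext j
    simp only [Z, Matrix.toLpLin_apply, ← Matrix.mulVec_mulVec]
    rfl
  have hlaw : ∀ v, ‖v‖ = 1 → HasLaw (fun ω => Z ω v) (stdGaussian _) P := by
    intro v hv
    simp_rw [hZ]
    refine hY.hasLaw_stdGaussian hV.posSemidef hb ?_ fun j => hbC j _
    rw [← hSS, ← Matrix.mulVec_mulVec, Matrix.dotProduct_mulVec, ← Matrix.mulVec_transpose, hSt,
      Matrix.mulVec_mulVec, Matrix.mul_nonsing_inv _ hSu, Matrix.one_mulVec]
    have := EuclideanSpace.real_norm_sq_eq v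
    rw [hv] at this
    simpa [dotProduct, sq] using this.symm
  rw [hdr]
  refine (hN d (by omega) (by omega) P Z hlaw).trans_le (measureReal_mono fun ω hω => ?_)
  refine le_minEigenvalue hq (rssMatrix_isHermitian X M _) fun u hu => ?_
  -- The factor `S⁻¹` in `Z` cancels, and `‖v‖²` is the form of `V₀` at `u`.
  let v : EuclideanSpace ℝ (Fin q) := WithLp.toLp 2 (S *ᵥ u.ofLp)
  have hlin : √τ * √d * ‖v‖ ≤ ‖Z ω v‖ := by
    rcases eq_or_ne v 0 with h | h
    · simp [h]
    · have h1 := hω (‖v‖⁻¹ • v) (norm_smul_inv_norm h)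
      rw [map_smul, norm_smul, norm_inv, norm_norm, inv_mul_eq_div,
        le_div_iff₀ (norm_pos_iff.2 h)] at h1
      exact h1
  have hv2 : ‖v‖ ^ 2 = u.ofLp ⬝ᵥ V₀ *ᵥ u.ofLp := by
    rw [← hSS, ← Matrix.mulVec_mulVec, Matrix.dotProduct_mulVec, ← Matrix.mulVec_transpose, hSt,
      EuclideanSpace.real_norm_sq_eq]
    simp [v, dotProduct, sq]
  have hmin : minEigenvalue V₀ ≤ ‖v‖ ^ 2 := by
    have h1 := minEigenvalue_mul_le hV.isHermitian u.ofLp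
    have h2 := EuclideanSpace.real_norm_sq_eq u
    have h3 : u.ofLp ⬝ᵥ u.ofLp = 1 := by
      rw [hu] at h2
      simpa [dotProduct, sq] using h2.symm
    rw [h3, mul_one] at h1
    rwa [hv2]
  have hZv : ‖Z ω v‖ ^ 2 = ∑ j, ((b j).ofLp ⬝ᵥ (Y ω)ᵀ *ᵥ u.ofLp) ^ 2 := by
    rw [hZ, EuclideanSpace.real_norm_sq_eq]
    simp [v, Matrix.mulVec_mulVec, Matrix.nonsing_inv_mul _ hSu]
  calc τ * d * minEigenvalue V₀ ≤ τ * d * ‖v‖ ^ 2 := by gcongr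
    _ = (√τ * √d * ‖v‖) ^ 2 := by
        rw [mul_pow, mul_pow, Real.sq_sqrt hτ₀.le, Real.sq_sqrt (Nat.cast_nonneg d)]
    _ ≤ ‖Z ω v‖ ^ 2 := by gcongr
    _ = _ := hZv
    _ ≤ _ := sum_sq_le_dotProduct_rssMatrix X M _ hb
      (fun j => Submodule.orthogonal_le le_sup_left (hbK j)) _
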